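/- For $n\ge 1$ let $\mathcal T_n$ be the set of alternating permutations of $[n]=\{1,\dots,n\}$, that is, the permutations $\sigma$ of $[n]$ such that $\sigma(2j)<\sigma(2j-1)$ and $\sigma(2j)<\sigma(2j+1)$ for every integer $j$ with $2\le 2j\le n-1$, and such that moreover $\sigma(n)<\sigma(n-1)$ if $n$ is even. Then (Désiré André) $$\tan u=\sum_{p\ge 1}\frac{u^{2p-1}}{(2p-1)!}\,\operatorname{card}\mathcal T_{2p-1},\qquad \frac1{\cos u}=1+\sum_{p\ge 1}\frac{u^{2p}}{(2p)!}\,\operatorname{card}\mathcal T_{2p}.$$ Both identities hold between formal power series in $u$ with rational coefficients (where $\tan u=\sin u\cdot(\cos u)^{-1}$), and also between functions: for every complex number $u$ with $|u|<\pi/2$ the two series converge and have the stated sums. -/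

import Mathlib

/-- A permutation `σ` of an `n`-element chain is alternating if, writing it on `{1, …, n}`,
`σ (2j) < σ (2j - 1)` and `σ (2j) < σ (2j + 1)` for every integer `j` with `2 ≤ 2j ≤ n - 1`,
and moreover `σ n < σ (n - 1)` when `n ≥ 2` is even.
Here positions and values are counted from `0`: the `i`-th position is `i - 1` in `Fin n`,
and `j` below stands for `j - 1`. -/
def IsAlternatingPerm {n : ℕ} (σ : Equiv.Perm (Fin n)) : Prop :=
  (∀ (j : ℕ) (h : 2 * j + 2 ≤ n - 1),
    σ ⟨2 * j + 1, by omega⟩ < σ ⟨2 * j, by omega⟩ ∧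
      σ ⟨2 * j + 1, by omega⟩ < σ ⟨2 * j + 2, by omega⟩) ∧
  (Even n → ∀ _h : 2 ≤ n, σ ⟨n - 1, by omega⟩ < σ ⟨n - 2, by omega⟩)

/-- The set of alternating permutations of an `n`-element chain. -/
def alternatingPerms (n : ℕ) : Set (Equiv.Perm (Fin n)) :=
  {σ | IsAlternatingPerm σ}

/-! Let `A n` count the alternating permutations of size `n`, and `D m` those of size `n` that
alternate up to position `m` and descend from there. If the first `2j` entries alternate and the
others descend, with the junction free, there are `n.choose (2j) * A (2j)` permutations. The
junction ascends or descends, so for `0 < 2j < n` this number is `D (2j) + D (2j-2)`. The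
alternating sum over `j` telescopes to `± A n`. For even `n` the extra term `2j = n` cancels it,
giving `secSeries * cos = 1`; for odd `n` it gives `secSeries * sin = tanSeries`. Taylor expansion
at `0` is multiplicative, so these are also the Taylor series of `1 / cos` and `tan`, which converge
on `|u| < π/2` because `cos` has no zero there. -/

open Finset

/-! ### Descent patterns -/

/-- The function `f` on a finite chain descends at each position `i` with `p i` and ascends at every
other position. -/
def HasDescentPattern {α : Type*} [LT α] {n : ℕ} (p : ℕ → Prop) (f : Fin n → α) : Prop :=
  ∀ (i : ℕ) (h : i + 1 < n),
    (p i → f ⟨i + 1, h⟩ < f ⟨i, by omega⟩) ∧ (¬ p i → f ⟨i, by omega⟩ < f ⟨i + 1, h⟩)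

open Classical in
/-- The number of permutations of `Fin n` with descent pattern `p`. -/
noncomputable def descentPatternCount (n : ℕ) (p : ℕ → Prop) : ℕ :=
  #{σ : Equiv.Perm (Fin n) | HasDescentPattern p σ}

theorem isAlternatingPerm_iff {n : ℕ} (σ : Equiv.Perm (Fin n)) :
    IsAlternatingPerm σ ↔ HasDescentPattern Even σ := by
  constructor
  · rintro ⟨h1, h2⟩ i hi
    constructor
    · rintro hp
      by_cases hn : i + 2 ≤ n - 1
      · obtain ⟨j, rfl⟩ := hp.two_dvd
        exact (h1 j hn).1
      · obtain rfl : n = i + 2 := by omega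
        exact h2 (by simpa [Nat.even_add] using hp) (by omega)
    · intro hp
      obtain ⟨j, rfl⟩ := Nat.not_even_iff_odd.1 hp
      exact (h1 j (by omega)).2
  · intro h
    refine ⟨fun j hj => ⟨(h (2 * j) (by omega)).1 (by simp),
      (h (2 * j + 1) (by omega)).2 (by simp)⟩, fun hn h2 => ?_⟩
    obtain ⟨m, rfl⟩ := Nat.exists_eq_add_of_le' h2
    exact (h m (by omega)).1 (by simpa [Nat.even_add] using hn)

theorem ncard_alternatingPerms (n : ℕ) :
    (alternatingPerms n).ncard = descentPatternCount n Even := by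
  classical
  rw [descentPatternCount, ← Set.ncard_coe_finset]
  congr 1
  ext σ
  simp [alternatingPerms, isAlternatingPerm_iff]

theorem HasDescentPattern.congr_lt_iff {α β : Type*} [LT α] [LT β] {n : ℕ} {p : ℕ → Prop}
    {f : Fin n → α} {g : Fin n → β} (h : ∀ i j, f i < f j ↔ g i < g j) :
    HasDescentPattern p f ↔ HasDescentPattern p g := by
  simp only [HasDescentPattern, h]

theorem descentPatternCount_congr {n : ℕ} {p q : ℕ → Prop} (h : ∀ i, i + 1 < n → (p i ↔ q i)) :
    descentPatternCount n p = descentPatternCount n q := by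
  classical
  refine congrArg card (filter_congr fun σ _ => ?_)
  refine forall_congr' fun i => forall_congr' fun hi => ?_
  rw [h i hi]

theorem hasDescentPattern_true_iff {α : Type*} [Preorder α] {n : ℕ} (f : Fin n → α) :
    HasDescentPattern (fun _ => True) f ↔ StrictAnti f := by
  cases n with
  | zero => simp [HasDescentPattern, StrictAnti]
  | succ n =>
    rw [Fin.strictAnti_iff_succ_lt]
    simp only [HasDescentPattern, forall_const, not_true_eq_false, false_imp_iff, and_true]
    exact ⟨fun h i => h i (by omega), fun h i hi => h ⟨i, by omega⟩⟩

theorem descentPatternCount_true (n : ℕ) : descentPatternCount n (fun _ => True) = 1 := by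
  classical
  rw [descentPatternCount, card_eq_one]
  refine ⟨Fin.revPerm, ?_⟩
  ext σ
  simp only [mem_filter, mem_univ, true_and, mem_singleton, hasDescentPattern_true_iff]
  constructor
  · intro h
    have h1 : StrictMono (σ * Fin.revPerm : Equiv.Perm (Fin n)) := h.comp Fin.rev_strictAnti
    have h2 := (Equiv.Perm.monotone_iff _).1 h1.monotone
    ext i : 1
    simpa using Equiv.congr_fun h2 i.rev
  · rintro rfl
    exact Fin.rev_strictAnti

/-- An injective function on `Fin n` is order-equivalent to a permutation. -/
theorem exists_perm_lt_iff_lt {α : Type*} [LinearOrder α] {n : ℕ} {f : Fin n → α}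
    (hf : Function.Injective f) : ∃ τ : Equiv.Perm (Fin n), ∀ i j, f i < f j ↔ τ i < τ j := by
  -- The inverse of the sorting permutation sends each index to the rank of its value.
  refine ⟨(Tuple.sort f)⁻¹, fun i j => ?_⟩
  have h : StrictMono (f ∘ Tuple.sort f) :=
    (Tuple.monotone_sort f).strictMono_of_injective (hf.comp (Tuple.sort f).injective)
  rw [← h.lt_iff_lt]
  simp

open Classical in
theorem card_perm_hasDescentPattern_comp {α : Type*} [LinearOrder α] {n : ℕ} (p : ℕ → Prop)
    {f : Fin n → α} (hf : Function.Injective f) :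
    #{a : Equiv.Perm (Fin n) | HasDescentPattern p (f ∘ a)} = descentPatternCount n p := by
  obtain ⟨τ, hτ⟩ := exists_perm_lt_iff_lt hf
  refine card_equiv (Equiv.mulLeft τ) fun a => ?_
  simp only [mem_filter, mem_univ, true_and, Equiv.coe_mulLeft]
  exact HasDescentPattern.congr_lt_iff fun i j => hτ _ _

/-! ### Splitting a permutation into two blocks -/

open Classical in
/-- Prescribing descent patterns independently on the first `m` and the last `k` positions. -/
theorem card_perm_hasDescentPattern_castAdd_natAdd (m k : ℕ) (p q : ℕ → Prop) :
    m.factorial * k.factorial * #{σ : Equiv.Perm (Fin (m + k)) |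
        HasDescentPattern p (σ ∘ Fin.castAdd k) ∧ HasDescentPattern q (σ ∘ Fin.natAdd m)} =
      (m + k).factorial * (descentPatternCount m p * descentPatternCount k q) := by
  set F : Equiv.Perm (Fin (m + k)) → Prop := fun σ =>
    HasDescentPattern p (σ ∘ Fin.castAdd k) ∧ HasDescentPattern q (σ ∘ Fin.natAdd m) with hF
  -- Double counting over the block permutations `e x`: right translation by `e x` preserves the
  -- total count, while for fixed `σ` the two blocks are rearranged independently.
  let e : Equiv.Perm (Fin m) × Equiv.Perm (Fin k) → Equiv.Perm (Fin (m + k)) := fun x =>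
    finSumFinEquiv.permCongr (Equiv.sumCongr x.1 x.2)
  have he1 : ∀ σ x, (σ * e x : Equiv.Perm (Fin (m + k))) ∘ Fin.castAdd k =
      (σ ∘ Fin.castAdd k) ∘ x.1 := by
    intro σ x; ext i; simp [e, Equiv.permCongr_apply]
  have he2 : ∀ σ x, (σ * e x : Equiv.Perm (Fin (m + k))) ∘ Fin.natAdd m =
      (σ ∘ Fin.natAdd m) ∘ x.2 := by
    intro σ x; ext i; simp [e, Equiv.permCongr_apply]
  have hinv : ∀ x, #{σ | F (σ * e x)} = #{σ | F σ} := fun x =>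
    card_equiv (Equiv.mulRight (e x)) fun a => by simp
  have hσ : ∀ σ, #{x | F (σ * e x)} = descentPatternCount m p * descentPatternCount k q := by
    intro σ
    rw [← card_perm_hasDescentPattern_comp p (σ.injective.comp (Fin.castAdd_injective m k)),
      ← card_perm_hasDescentPattern_comp q (σ.injective.comp (Fin.natAdd_injective k m)),
      ← card_product]
    congr 1
    ext x
    simp only [hF, mem_filter, mem_univ, true_and, mem_product, he1, he2]
  calc
    _ = ∑ x : Equiv.Perm (Fin m) × Equiv.Perm (Fin k), #{σ | F (σ * e x)} := by
      simp only [hinv, sum_const, card_univ, Fintype.card_prod, Fintype.card_perm, Fintype.card_fin,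
        smul_eq_mul]
      congr!
    _ = ∑ σ : Equiv.Perm (Fin (m + k)), #{x | F (σ * e x)} := by
      simp only [card_filter]
      exact sum_comm
    _ = _ := by simp [hσ, Fintype.card_perm]

theorem hasDescentPattern_add_iff {α : Type*} [LT α] {m k : ℕ} {p : ℕ → Prop}
    {f : Fin (m + 1 + (k + 1)) → α} :
    HasDescentPattern p f ↔
      (HasDescentPattern p (f ∘ Fin.castAdd (k + 1)) ∧
        HasDescentPattern (fun i => p (m + 1 + i)) (f ∘ Fin.natAdd (m + 1))) ∧
      (p m → f ⟨m + 1, by omega⟩ < f ⟨m, by omega⟩) ∧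
      (¬ p m → f ⟨m, by omega⟩ < f ⟨m + 1, by omega⟩) := by
  constructor
  · exact fun h => ⟨⟨fun i hi => h i (by omega), fun i hi => h (m + 1 + i) (by omega)⟩,
      h m (by omega)⟩
  · rintro ⟨⟨h1, h2⟩, h3⟩ i hi
    rcases lt_trichotomy i m with h | rfl | h
    · exact h1 i (by omega)
    · exact h3
    · obtain ⟨j, rfl⟩ := Nat.exists_eq_add_of_le (Nat.succ_le_of_lt h)
      exact h2 j (by omega)

open Classical in
/-- If two patterns differ exactly at position `m`, then together they count the permutations for
which position `m` is unconstrained. -/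
theorem descentPatternCount_add_of_differ {m k : ℕ} {p q : ℕ → Prop} (hp : p m) (hq : ¬ q m)
    (h : ∀ i, i ≠ m → (p i ↔ q i)) :
    descentPatternCount (m + 1 + (k + 1)) q + descentPatternCount (m + 1 + (k + 1)) p =
      #{σ : Equiv.Perm (Fin (m + 1 + (k + 1))) |
        HasDescentPattern p (σ ∘ Fin.castAdd (k + 1)) ∧
          HasDescentPattern (fun i => p (m + 1 + i)) (σ ∘ Fin.natAdd (m + 1))} := by
  have hqp : ∀ σ : Equiv.Perm (Fin (m + 1 + (k + 1))),
      (HasDescentPattern q (σ ∘ Fin.castAdd (k + 1)) ∧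
        HasDescentPattern (fun i => q (m + 1 + i)) (σ ∘ Fin.natAdd (m + 1))) ↔
      (HasDescentPattern p (σ ∘ Fin.castAdd (k + 1)) ∧
        HasDescentPattern (fun i => p (m + 1 + i)) (σ ∘ Fin.natAdd (m + 1))) := by
    intro σ
    refine and_congr ?_ ?_
    · refine forall_congr' fun i => forall_congr' fun hi => ?_
      rw [h i (by omega)]
    · refine forall_congr' fun i => forall_congr' fun hi => ?_
      simp only [h (m + 1 + i) (by omega)]
  rw [descentPatternCount, descentPatternCount, ← card_union_of_disjoint]
  · congr 1
    ext σ
    simp only [mem_union, mem_filter, mem_univ, true_and]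
    rw [hasDescentPattern_add_iff, hasDescentPattern_add_iff (p := p), hqp]
    simp only [hp, hq, forall_const, not_true_eq_false, not_false_eq_true, false_imp_iff, true_and,
      and_true, ← and_or_left, and_iff_left_iff_imp]
    intro _
    exact lt_or_gt_of_ne (σ.injective.ne (by simp))
  · rw [disjoint_filter]
    intro σ _ h1 h2
    exact lt_asymm ((h1 m (by omega)).2 hq) ((h2 m (by omega)).1 hp)

/-! ### The telescoping recurrence -/

/-- The pattern that alternates before position `m` and descends from there on. -/
def AlternatingThenDescending (m i : ℕ) : Prop := Even i ∨ m ≤ i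

theorem factorial_mul_descentPatternCount_even (j k : ℕ) :
    (2 * j + 2 + (k + 1)).factorial * descentPatternCount (2 * j + 2) Even =
      (2 * j + 2).factorial * (k + 1).factorial *
        (descentPatternCount (2 * j + 2 + (k + 1)) (AlternatingThenDescending (2 * j + 2)) +
          descentPatternCount (2 * j + 2 + (k + 1)) (AlternatingThenDescending (2 * j))) := by
  classical
  -- The two patterns differ only at the junction `2 * j + 1`: an ascent for `2 * j + 2`, a descent
  -- for `2 * j`.
  rw [descentPatternCount_add_of_differ (m := 2 * j + 1),
    card_perm_hasDescentPattern_castAdd_natAdd,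
    descentPatternCount_congr (n := k + 1) (q := fun _ => True),
    descentPatternCount_true, mul_one,
    descentPatternCount_congr (n := 2 * j + 1 + 1)
      (p := AlternatingThenDescending (2 * j)) (q := Even)]
  all_goals grind [AlternatingThenDescending]

theorem descentPatternCount_alternatingThenDescending_zero (n : ℕ) :
    descentPatternCount n (AlternatingThenDescending 0) = 1 := by
  rw [← descentPatternCount_true n]
  exact descentPatternCount_congr (by simp [AlternatingThenDescending])

/-- The patterns first disagree at position `2 * m + 1`, which needs at least `2 * m + 3` entries.
-/
theorem descentPatternCount_alternatingThenDescending_of_le {n m : ℕ} (h : n ≤ 2 * m + 2) :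
    descentPatternCount n (AlternatingThenDescending (2 * m)) = descentPatternCount n Even :=
  descentPatternCount_congr fun i _ => by simp only [AlternatingThenDescending]; grind

theorem descentPatternCount_zero (p : ℕ → Prop) : descentPatternCount 0 p = 1 := by
  rw [← descentPatternCount_true 0]
  exact descentPatternCount_congr (by simp)

open Nat in
theorem sum_range_descentPatternCount_even {n J : ℕ} (h : 2 * J < n) :
    ∑ j ∈ range (J + 1), (-1 : ℚ) ^ j * (descentPatternCount (2 * j) Even / ((2 * j)! : ℚ) /
      ((n - 2 * j)! : ℚ)) =
      (-1) ^ J * descentPatternCount n (AlternatingThenDescending (2 * J)) / (n ! : ℚ) := by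
  induction J with
  | zero =>
    simp [descentPatternCount_zero, descentPatternCount_alternatingThenDescending_zero]
  | succ J ih =>
    rw [sum_range_succ, ih (by omega)]
    obtain ⟨k, rfl⟩ : ∃ k, n = 2 * J + 2 + (k + 1) := ⟨n - (2 * J + 3), by omega⟩
    have key := factorial_mul_descentPatternCount_even J k
    rw [← @Nat.cast_inj ℚ] at key
    push_cast at key
    have h1 : ((2 * J + 2)! : ℚ) ≠ 0 := by positivity
    have h2 : ((k + 1)! : ℚ) ≠ 0 := by positivity
    have h3 : ((2 * J + 2 + (k + 1))! : ℚ) ≠ 0 := by positivity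
    have h4 : 2 * J + 2 + (k + 1) - 2 * (J + 1) = k + 1 := by omega
    rw [h4, mul_add_one]
    rw [div_div, ← mul_div_assoc, div_add_div _ _ h3 (by positivity),
      div_eq_div_iff (by positivity) h3, pow_succ]
    linear_combination (-1) * (-1 : ℚ) ^ J * ((2 * J + 2 + (k + 1))! : ℚ) * key

/-! ### Identities of formal power series -/

/-- The exponential generating function of the alternating permutations of even size. -/
noncomputable def secSeries : PowerSeries ℚ :=
  PowerSeries.mk fun n => if Even n then (descentPatternCount n Even : ℚ) / (n.factorial : ℚ) else 0

/-- The exponential generating function of the alternating permutations of odd size. -/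
noncomputable def tanSeries : PowerSeries ℚ :=
  PowerSeries.mk fun n => if Odd n then (descentPatternCount n Even : ℚ) / (n.factorial : ℚ) else 0

theorem sum_range_eq_sum_range_even {M : Type*} [AddCommMonoid M] (f : ℕ → M) (N : ℕ)
    (hf : ∀ n, Odd n → f n = 0) :
    ∑ i ∈ range (2 * N + 1), f i = ∑ j ∈ range (N + 1), f (2 * j) := by
  induction N with
  | zero => simp
  | succ N ih =>
    rw [sum_range_succ _ (N + 1), ← ih, mul_add_one, sum_range_succ, sum_range_succ,
      hf (2 * N + 1) (by simp), add_zero]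

open Nat in
theorem secSeries_mul_cos : secSeries * PowerSeries.cos ℚ = 1 := by
  ext n
  rw [PowerSeries.coeff_mul, Nat.sum_antidiagonal_eq_sum_range_succ_mk, PowerSeries.coeff_one]
  simp only [secSeries, PowerSeries.cos, PowerSeries.coeff_mk, eq_ratCast, Rat.cast_id]
  rcases Nat.even_or_odd n with hn | hn
  · obtain ⟨N, rfl⟩ := hn.two_dvd
    rw [Nat.succ_eq_add_one, sum_range_eq_sum_range_even _ _ fun n hn => by
      simp [Nat.not_even_iff_odd.2 hn]]
    have h : ∀ j ∈ range (N + 1),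
        ((if Even (2 * j) then (descentPatternCount (2 * j) Even : ℚ) / ((2 * j)! : ℚ) else 0) *
          if Even (2 * N - 2 * j) then
            ((-1) ^ ((2 * N - 2 * j) / 2) / ((2 * N - 2 * j)! : ℚ) : ℚ) else 0) =
        (-1) ^ N * ((-1 : ℚ) ^ j * (descentPatternCount (2 * j) Even / ((2 * j)! : ℚ) /
          ((2 * N - 2 * j)! : ℚ))) := by
      intro j hj
      obtain ⟨i, rfl⟩ := Nat.exists_eq_add_of_le (Nat.lt_succ_iff.1 (mem_range.1 hj))
      have hi : 2 * (j + i) - 2 * j = 2 * i := by omega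
      have hs : ((-1 : ℚ) ^ j) * (-1) ^ j = 1 := by rw [← mul_pow]; simp
      rw [hi, if_pos (by simp), if_pos (by simp), Nat.mul_div_cancel_left _ two_pos, pow_add]
      linear_combination (-1 : ℚ) * (-1) ^ i * (descentPatternCount (2 * j) Even / ((2 * j)! : ℚ) /
          ((2 * i)! : ℚ)) * hs
    rw [sum_congr rfl h, ← mul_sum]
    cases N with
    | zero => simp [descentPatternCount_zero]
    | succ N =>
      -- The telescoped sum stops at `j = N`; the remaining term `j = N + 1` is its opposite.
      rw [sum_range_succ, sum_range_descentPatternCount_even (by omega),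
        descentPatternCount_alternatingThenDescending_of_le (by omega), if_neg (by omega)]
      simp only [Nat.sub_self, Nat.factorial_zero, Nat.cast_one, div_one]
      ring
  · rw [if_neg hn.pos.ne']
    refine sum_eq_zero fun i hi => ?_
    have := mem_range.1 hi
    split_ifs <;> first | (exfalso; grind) | simp

open Nat in
theorem secSeries_mul_sin : secSeries * PowerSeries.sin ℚ = tanSeries := by
  ext n
  rw [PowerSeries.coeff_mul, Nat.sum_antidiagonal_eq_sum_range_succ_mk]
  simp only [secSeries, tanSeries, PowerSeries.sin, PowerSeries.coeff_mk, eq_ratCast, Rat.cast_id]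
  rcases Nat.even_or_odd n with hn | hn
  · rw [if_neg (Nat.not_odd_iff_even.2 hn)]
    refine sum_eq_zero fun i hi => ?_
    have := mem_range.1 hi
    split_ifs <;> first | (exfalso; grind) | simp
  · obtain ⟨N, rfl⟩ := hn
    rw [Nat.succ_eq_add_one, sum_range_succ, sum_range_eq_sum_range_even _ _ fun n hn => by
      simp [Nat.not_even_iff_odd.2 hn]]
    have h : ∀ j ∈ range (N + 1),
        ((if Even (2 * j) then (descentPatternCount (2 * j) Even : ℚ) / ((2 * j)! : ℚ) else 0) *
          if Even (2 * N + 1 - 2 * j) then 0 else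
            ((-1) ^ ((2 * N + 1 - 2 * j) / 2) / ((2 * N + 1 - 2 * j)! : ℚ) : ℚ)) =
        (-1) ^ N * ((-1 : ℚ) ^ j * (descentPatternCount (2 * j) Even / ((2 * j)! : ℚ) /
          ((2 * N + 1 - 2 * j)! : ℚ))) := by
      intro j hj
      obtain ⟨i, rfl⟩ := Nat.exists_eq_add_of_le (Nat.lt_succ_iff.1 (mem_range.1 hj))
      have hi : 2 * (j + i) + 1 - 2 * j = 2 * i + 1 := by omega
      have hi2 : (2 * i + 1) / 2 = i := by omega
      have hs : ((-1 : ℚ) ^ j) * (-1) ^ j = 1 := by rw [← mul_pow]; simp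
      rw [hi, if_pos (by simp), if_neg (by simp), hi2, pow_add]
      linear_combination (-1 : ℚ) * (-1) ^ i * (descentPatternCount (2 * j) Even / ((2 * j)! : ℚ) /
          ((2 * i + 1)! : ℚ)) * hs
    have hs : ((-1 : ℚ) ^ N) * (-1) ^ N = 1 := by rw [← mul_pow]; simp
    rw [sum_congr rfl h, ← mul_sum, sum_range_descentPatternCount_even (by omega),
      descentPatternCount_alternatingThenDescending_of_le (by omega)]
    simp only [Nat.sub_self, Even.zero, if_true, mul_zero, add_zero, odd_two_mul_add_one]
    linear_combination (descentPatternCount (2 * N + 1) Even / ((2 * N + 1)! : ℚ)) * hs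

theorem cos_inv_eq_secSeries : (PowerSeries.cos ℚ)⁻¹ = secSeries := by
  have h : PowerSeries.constantCoeff (PowerSeries.cos ℚ) ≠ 0 := by
    rw [← PowerSeries.coeff_zero_eq_constantCoeff_apply]
    simp [PowerSeries.cos]
  rw [PowerSeries.inv_eq_iff_mul_eq_one h, secSeries_mul_cos]

/-! ### Convergence on the disc -/

/-- The Taylor series at `0` of a complex function, as a formal power series. -/
noncomputable def taylorPowerSeries (f : ℂ → ℂ) : PowerSeries ℂ :=
  PowerSeries.mk fun n => iteratedDeriv n f 0 / (n.factorial : ℂ)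

/-- This is the Leibniz rule divided by `n!`. -/
theorem taylorPowerSeries_mul {f g : ℂ → ℂ} (hf : AnalyticAt ℂ f 0) (hg : AnalyticAt ℂ g 0) :
    taylorPowerSeries (f * g) = taylorPowerSeries f * taylorPowerSeries g := by
  ext n
  rw [PowerSeries.coeff_mul, Nat.sum_antidiagonal_eq_sum_range_succ_mk]
  simp only [taylorPowerSeries, PowerSeries.coeff_mk]
  rw [iteratedDeriv_mul hf.contDiffAt hg.contDiffAt, sum_div]
  refine sum_congr rfl fun i hi => ?_
  have hi := Nat.lt_succ_iff.1 (mem_range.1 hi)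
  rw [Nat.cast_choose ℂ hi]
  have h1 : (n.factorial : ℂ) ≠ 0 := by exact_mod_cast n.factorial_ne_zero
  field_simp

theorem taylorPowerSeries_cos : taylorPowerSeries Complex.cos = PowerSeries.cos ℂ := by
  ext n
  rcases Nat.even_or_odd n with hn | hn
  · obtain ⟨k, rfl⟩ := hn.two_dvd
    simp [taylorPowerSeries, PowerSeries.cos]
  · obtain ⟨k, rfl⟩ := hn
    simp [taylorPowerSeries, PowerSeries.cos]

theorem taylorPowerSeries_sin : taylorPowerSeries Complex.sin = PowerSeries.sin ℂ := by
  ext n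
  rcases Nat.even_or_odd n with hn | hn
  · obtain ⟨k, rfl⟩ := hn.two_dvd
    simp [taylorPowerSeries, PowerSeries.sin]
  · obtain ⟨k, rfl⟩ := hn
    have hk : (2 * k + 1) / 2 = k := by omega
    simp [taylorPowerSeries, PowerSeries.sin, hk]

theorem taylorPowerSeries_one : taylorPowerSeries 1 = 1 := by
  ext n
  rw [taylorPowerSeries, PowerSeries.coeff_mk, PowerSeries.coeff_one, Pi.one_def,
    iteratedDeriv_const]
  split_ifs with h <;> simp [h]

theorem taylorPowerSeries_congr {f g : ℂ → ℂ} (h : f =ᶠ[nhds 0] g) :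
    taylorPowerSeries f = taylorPowerSeries g := by
  ext n
  simp only [taylorPowerSeries, PowerSeries.coeff_mk, h.iteratedDeriv_eq n]

theorem hasSum_coeff_taylorPowerSeries {f : ℂ → ℂ} {r : ℝ} {z : ℂ}
    (hf : DifferentiableOn ℂ f (Metric.ball 0 r)) (hz : ‖z‖ < r) :
    HasSum (fun n => PowerSeries.coeff n (taylorPowerSeries f) * z ^ n) (f z) := by
  refine (Complex.hasSum_taylorSeries_on_ball hf (by simpa using hz)).congr_fun ?_
  intro n
  simp only [taylorPowerSeries, PowerSeries.coeff_mk, smul_eq_mul, sub_zero]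
  ring

theorem Complex.cos_ne_zero_of_norm_lt_pi_div_two {z : ℂ} (hz : ‖z‖ < Real.pi / 2) :
    Complex.cos z ≠ 0 := by
  rw [Complex.cos_ne_zero_iff]
  rintro k rfl
  -- The zeros of `cos` are the odd multiples of `π / 2`, and an odd integer has absolute value at
  -- least `1`.
  have h1 : (1 : ℝ) ≤ |(2 * k + 1 : ℝ)| := by
    have : (1 : ℤ) ≤ |2 * k + 1| := Int.one_le_abs (by omega)
    exact_mod_cast this
  have h2 : ‖((2 * k + 1) * Real.pi / 2 : ℂ)‖ = |(2 * k + 1 : ℝ)| * (Real.pi / 2) := by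
    rw [← abs_of_pos Real.pi_div_two_pos, ← abs_mul, ← Real.norm_eq_abs, ← Complex.norm_real]
    congr 1
    push_cast
    ring
  rw [h2] at hz
  nlinarith [Real.pi_div_two_pos]

theorem Complex.analyticAt_inv_cos_zero : AnalyticAt ℂ (fun z => (Complex.cos z)⁻¹) 0 :=
  Complex.analyticAt_cos.inv (Complex.cos_zero.trans_ne one_ne_zero)

theorem taylorPowerSeries_inv_cos :
    taylorPowerSeries (fun z => (Complex.cos z)⁻¹) =
      PowerSeries.map (algebraMap ℚ ℂ) secSeries := by
  have h1 : taylorPowerSeries (fun z => (Complex.cos z)⁻¹) * PowerSeries.cos ℂ = 1 := by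
    rw [← taylorPowerSeries_cos, ← taylorPowerSeries_mul Complex.analyticAt_inv_cos_zero
      Complex.analyticAt_cos, ← taylorPowerSeries_one]
    refine taylorPowerSeries_congr ?_
    have h0 : Complex.cos 0 ≠ 0 := Complex.cos_zero.trans_ne one_ne_zero
    filter_upwards [Complex.continuous_cos.continuousAt.eventually_ne h0] with z hz
    exact inv_mul_cancel₀ hz
  have h2 : PowerSeries.cos ℂ * PowerSeries.map (algebraMap ℚ ℂ) secSeries = 1 := by
    rw [← PowerSeries.map_cos (algebraMap ℚ ℂ), ← map_mul, mul_comm, secSeries_mul_cos, map_one]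
  exact left_inv_eq_right_inv h1 h2

theorem taylorPowerSeries_tan :
    taylorPowerSeries Complex.tan = PowerSeries.map (algebraMap ℚ ℂ) tanSeries := by
  have h : Complex.tan = (fun z => (Complex.cos z)⁻¹) * Complex.sin := by
    ext z
    simp [Complex.tan, div_eq_mul_inv, mul_comm]
  rw [h, taylorPowerSeries_mul Complex.analyticAt_inv_cos_zero Complex.analyticAt_sin,
    taylorPowerSeries_inv_cos, taylorPowerSeries_sin, ← PowerSeries.map_sin (algebraMap ℚ ℂ),
    ← map_mul, secSeries_mul_sin]

theorem hasSum_inv_cos {u : ℂ} (hu : ‖u‖ < Real.pi / 2) :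
    HasSum (fun p : ℕ => u ^ (2 * p) / ((2 * p).factorial : ℂ) *
      (descentPatternCount (2 * p) Even : ℂ)) (Complex.cos u)⁻¹ := by
  have h := hasSum_coeff_taylorPowerSeries (f := fun z => (Complex.cos z)⁻¹)
    (fun z hz => (Complex.differentiableAt_cos.inv
      (Complex.cos_ne_zero_of_norm_lt_pi_div_two (by simpa using hz))).differentiableWithinAt) hu
  rw [taylorPowerSeries_inv_cos] at h
  rw [← Function.Injective.hasSum_iff (mul_right_injective₀ (two_ne_zero' ℕ))] at h
  · refine h.congr_fun fun p => ?_
    simp [secSeries]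
    ring
  · intro n hn
    have : ¬ Even n := fun h => hn (by obtain ⟨k, rfl⟩ := h.two_dvd; exact ⟨k, rfl⟩)
    simp [secSeries, this]

theorem hasSum_tan {u : ℂ} (hu : ‖u‖ < Real.pi / 2) :
    HasSum (fun p : ℕ => u ^ (2 * p + 1) / ((2 * p + 1).factorial : ℂ) *
      (descentPatternCount (2 * p + 1) Even : ℂ)) (Complex.tan u) := by
  have h := hasSum_coeff_taylorPowerSeries (f := Complex.tan)
    (fun z hz => (Complex.differentiableAt_tan.2
      (Complex.cos_ne_zero_of_norm_lt_pi_div_two (by simpa using hz))).differentiableWithinAt) hu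
  rw [taylorPowerSeries_tan] at h
  rw [← Function.Injective.hasSum_iff (g := fun p : ℕ => 2 * p + 1)
    (fun a b hab => by simpa using hab)] at h
  · refine h.congr_fun fun p => ?_
    simp [tanSeries]
    ring
  · intro n hn
    have : ¬ Odd n := fun ⟨k, hk⟩ => hn ⟨k, hk.symm⟩
    simp [tanSeries, this]

theorem mainTheorem12 :
    -- the identities between formal power series with rational coefficients
    (PowerSeries.sin ℚ * (PowerSeries.cos ℚ)⁻¹ =
      PowerSeries.mk (fun n : ℕ =>
        if Odd n then ((alternatingPerms n).ncard : ℚ) / (n.factorial : ℚ) else 0)) ∧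
    ((PowerSeries.cos ℚ)⁻¹ =
      1 + PowerSeries.mk (fun n : ℕ =>
        if Even n ∧ 2 ≤ n then ((alternatingPerms n).ncard : ℚ) / (n.factorial : ℚ) else 0)) ∧
    -- the same expansions as convergent series, with `p + 1` in place of `p ≥ 1`
    (∀ u : ℂ, ‖u‖ < Real.pi / 2 →
      HasSum (fun p : ℕ => u ^ (2 * (p + 1) - 1) / ((2 * (p + 1) - 1).factorial : ℂ) *
          ((alternatingPerms (2 * (p + 1) - 1)).ncard : ℂ))
        (Complex.tan u)) ∧
    (∀ u : ℂ, ‖u‖ < Real.pi / 2 →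
      Summable (fun p : ℕ => u ^ (2 * (p + 1)) / ((2 * (p + 1)).factorial : ℂ) *
          ((alternatingPerms (2 * (p + 1))).ncard : ℂ)) ∧
      1 / Complex.cos u =
        1 + ∑' p : ℕ, u ^ (2 * (p + 1)) / ((2 * (p + 1)).factorial : ℂ) *
          ((alternatingPerms (2 * (p + 1))).ncard : ℂ)) := by
  simp only [ncard_alternatingPerms]
  refine ⟨?_, ?_, fun u hu => hasSum_tan hu, fun u hu => ?_⟩
  · rw [cos_inv_eq_secSeries, mul_comm, secSeries_mul_sin, tanSeries]
  · rw [cos_inv_eq_secSeries]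
    ext n
    rcases n with _ | _ | n
    · simp [secSeries, descentPatternCount_zero]
    · simp [secSeries, PowerSeries.coeff_one]
    · simp [secSeries, PowerSeries.coeff_one]
  · have h := hasSum_inv_cos hu
    refine ⟨(summable_nat_add_iff 1).2 h.summable, ?_⟩
    rw [one_div, ← h.tsum_eq, h.summable.tsum_eq_zero_add]
    simp [descentPatternCount_zero]
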